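/- Let $G=(V,E)$ be a known finite directed graph with $n=|V|$ nodes and $m=|E|$ edges and an unknown parameter $w_e$ on every edge. From a seed set $S\subseteq V$, active from the start, a diffusion process activates further nodes, and active nodes stay active. In the discrete-time independent cascade (DIC) model, every node $u$ that was newly activated in the previous step (at first, every seed) makes one attempt at each inactive out-neighbour $v$, which succeeds independently with probability $w_{uv}$. In the discrete-time linear threshold (DLT) model, each node $v$ draws an independent threshold $\theta_v$ uniformly from $[0,1]$ and is active at a step if it was active before or if $\sum_{u\in N(v),\,u\text{ active at the previous step}}w_{uv}\ge\theta_v$, where $N(v)$ is the set of in-neighbours of $v$. Let $A$ be the random final active set and $F^w:2^V\to[0,1]^V$, $F^w_v(S)=\Pr[v\in A]$, the influence function. An incomplete cascade with retention rate $r$ is the pair $(S,\tilde A)$ where $\tilde A\supseteq S$ contains each $v\in A\setminus S$ independently with probability $r$. For a distribution $\mathcal P$ on seed sets put $\mathrm{err}[F]=\mathbb E_{S\sim\mathcal P,\,A}\bigl[\tfrac1n\|\mathbf 1_A-F(S)\|_2^2\bigr]$. Let $\lambda\in(0,\tfrac12)$, $\bar r>0$, $\eta\in[0,1)$, and consider either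 of the following classes $\mathcal F$ of influence functions: (a) DIC with all $w_e\in[\lambda,1-\lambda]$; (b) DLT with all $w_e\in[\lambda,1-\lambda]$ and $1-\sum_{u\in N(v)}w_{uv}\in[\lambda,1-\lambda]$ for every node $v$ with at least one incoming edge. There is a learning algorithm, which may depend on $G,\lambda,\bar r,\eta$ but not on $w$, $\mathcal P$ or the true retention rate, which maps any finite sequence of incomplete cascades to an influence function $F$, is proper (if $\mathcal F\neq\emptyset$, then always $F\in\mathcal F$), and has the following property. For all $\varepsilon,\delta\in(0,1)$, every ground truth $F^*\in\mathcal F$, every distribution $\mathcal P$ on seed sets and every (adversarially chosen) true retention rate $r\in[\bar r(1-\eta),\bar r(1+\eta)]$ with $r\le1$, given $M$ independent incomplete cascades with seed sets drawn from $\mathcal P$, $$\Pr\Bigl[\mathrm{err}[F]-\mathrm{err}[F^*]\ \ge\ \varepsilon+\frac{4\eta^2}{(1-\eta)^2}\Bigr]\le\delta$$ whenever $$M\ \ge\ C\,\frac{n^3m}{\varepsilon^4r^4(1-\eta)^4}\,\Bigl(\log\bigl(n+m+\tfrac1\varepsilon+\tfrac1\delta+\tfrac1r+\tfrac1{1-\eta}\bigr)\Bigr)^{k},$$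 where $C>0$ and $k\in\mathbb N$ are absolute constants; that is, $M=\tilde O\bigl(\tfrac{n^3m}{\varepsilon^4r^4(1-\eta)^4}\bigr)$ incomplete cascades suffice. -/

import Mathlib

open MeasureTheory

universe u

noncomputable section

namespace Diffusion

/-! Throughout, `V` is the finite set of nodes and `E` the set of directed edges `(u, v)` of the
known graph; edge parameters are vectors `w : E → ℝ`.  A random variable that is uniform on
`[0, 1]` is a point of `unitInterval` under `volume`; families indexed by a finite type carry the
product measure, that is, their members are independent. -/

/-- Independent cascade dynamics: the pair `(active nodes, newly active nodes)` after `t` steps.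
Each newly active `u` makes one attempt along every edge `(u, v)` to an inactive node `v` (so an
edge is tried at most once); the attempt succeeds iff its private uniform variable `U (u, v)` is
at most `w (u, v)`, an event of probability `w (u, v)`. -/
def dicState {V : Type u} {E : Finset (V × V)} (w : E → ℝ) (S : Set V) (U : E → unitInterval) :
    ℕ → Set V × Set V
  | 0 => (S, S)
  | t + 1 =>
    let active := (dicState w S U t).1
    let fresh := (dicState w S U t).2
    let next := {v | v ∉ active ∧
      ∃ u ∈ fresh, ∃ h : (u, v) ∈ E, (U ⟨(u, v), h⟩ : ℝ) ≤ w ⟨(u, v), h⟩}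
    (active ∪ next, next)

/-- The final active set of the independent cascade process: all nodes ever active. -/
def dicFinal {V : Type u} {E : Finset (V × V)} (w : E → ℝ) (S : Set V) (U : E → unitInterval) :
    Set V :=
  ⋃ t, (dicState w S U t).1

/-- The total weight of the edges that enter `v` from nodes in `A`. -/
def inWeight {V : Type u} {E : Finset (V × V)} (w : E → ℝ) (A : Set V) (v : V) : ℝ :=
  ∑ e : E, Set.indicator {e : E | e.1.2 = v ∧ e.1.1 ∈ A} w e

/-- Linear threshold dynamics: the active nodes after `t` steps, for thresholds `θ`. -/
def dltState {V : Type u} {E : Finset (V × V)} (w : E → ℝ) (S : Set V) (θ : V → unitInterval) :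
    ℕ → Set V
  | 0 => S
  | t + 1 => dltState w S θ t ∪ {v | (θ v : ℝ) ≤ inWeight w (dltState w S θ t) v}

/-- The final active set of the linear threshold process: all nodes ever active. -/
def dltFinal {V : Type u} {E : Finset (V × V)} (w : E → ℝ) (S : Set V) (θ : V → unitInterval) :
    Set V :=
  ⋃ t, dltState w S θ t

/-- Parameters of the constrained independent cascade class. -/
def dicParams {V : Type u} (E : Finset (V × V)) (lam : ℝ) : Set (E → ℝ) :=
  {w | ∀ e, w e ∈ Set.Icc lam (1 - lam)}

/-- Parameters of the constrained linear threshold class.  The condition on the total incoming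
weight concerns the nodes that have an incoming edge: for a node without one the total is `0`. -/
def dltParams {V : Type u} (E : Finset (V × V)) (lam : ℝ) : Set (E → ℝ) :=
  {w | (∀ e, w e ∈ Set.Icc lam (1 - lam)) ∧
    ∀ v, (∃ u, (u, v) ∈ E) → 1 - inWeight w Set.univ v ∈ Set.Icc lam (1 - lam)}

/-- The influence function of a process whose final active set from the seed set `S` is
`act S ω`, with `ω` the internal randomness: the vector of marginal activation probabilities. -/
def influence {V : Type u} {Ω : Type u} [MeasureSpace Ω] (act : Set V → Ω → Set V) :
    Set V → V → ℝ :=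
  fun S v => (volume : Measure Ω).real {ω | v ∈ act S ω}

/-- The quadratic loss `(1 / n) * ‖x - y‖²` of vectors indexed by the nodes. -/
def sqLoss {V : Type u} [Fintype V] (x y : V → ℝ) : ℝ :=
  (1 / (Fintype.card V : ℝ)) * ∑ v, (x v - y v) ^ 2

/-- The squared error of `F`: the expected quadratic loss between the (indicator of the complete)
final active set and `F S`, over `S ∼ P` and the diffusion process. -/
def sqErr {V : Type u} [Fintype V] {Ω : Type u} [MeasureSpace Ω] (P : Measure (Set V))
    (act : Set V → Ω → Set V) (F : Set V → V → ℝ) : ℝ :=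
  ∫ x, sqLoss (Set.indicator (act x.1 x.2) 1) (F x.1) ∂(P.prod (volume : Measure Ω))

/-- The incomplete cascade: seeds are always observed, and any other active node `v` is observed
iff its own uniform variable `R v` is at most `r`, an event of probability `r`. -/
def incompleteCascade {V : Type u} {Ω : Type u} (act : Set V → Ω → Set V) (r : ℝ)
    (x : Set V × Ω × (V → unitInterval)) : Set V × Set V :=
  (x.1, x.1 ∪ {v | v ∈ act x.1 x.2.1 \ x.1 ∧ (x.2.2 v : ℝ) ≤ r})

/-- The joint law of all the randomness behind `M` independent incomplete cascades: seed sets from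
`P`, diffusion processes, and observation losses. -/
def sampleLaw {V : Type u} [Fintype V] (Ω : Type u) [MeasureSpace Ω] (P : Measure (Set V))
    (M : ℕ) : Measure (Fin M → Set V × Ω × (V → unitInterval)) :=
  Measure.pi fun _ => P.prod ((volume : Measure Ω).prod (volume : Measure (V → unitInterval)))

/-- A learner maps any finite sequence of (incomplete) cascades `(S, A)` to an influence
function. -/
abbrev Learner (V : Type u) : Type u :=
  (M : ℕ) → (Fin M → Set V × Set V) → Set V → V → ℝ

/-- The learner `L` is proper for the class of influence functions with parameters in `W`
(whenever there is such a function). -/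
def IsProper {V : Type u} {Ω : Type u} [MeasureSpace Ω] {E : Finset (V × V)}
    (model : (E → ℝ) → Set V → Ω → Set V) (W : Set (E → ℝ)) (L : Learner V) : Prop :=
  W.Nonempty → ∀ M D, ∃ w ∈ W, L M D = influence (model w)

/-- The bound `C * n³ m / (ε⁴ r⁴ (1 - η)⁴)` times the `k`-th power of a logarithm of
`n, m, 1/ε, 1/δ, 1/r, 1/(1 - η)`. -/
def sampleBound (C : ℝ) (k n m : ℕ) (ε δ r η : ℝ) : ℝ :=
  C * ((n : ℝ) ^ 3 * m / (ε ^ 4 * r ^ 4 * (1 - η) ^ 4)) *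
    Real.log (n + m + 1 / ε + 1 / δ + 1 / r + 1 / (1 - η)) ^ k

/-- With `M ≥ sampleBound C k …` incomplete cascades of any ground truth `w` in `W`, any seed
distribution and any retention rate `r` in the interval, the learner `L` has excess squared error
at least `ε + 4 η² / (1 - η)²` with probability at most `δ`. -/
def LearnsUnderIntervalRate {V : Type u} [Fintype V] {Ω : Type u} [MeasureSpace Ω]
    {E : Finset (V × V)} (model : (E → ℝ) → Set V → Ω → Set V) (W : Set (E → ℝ)) (L : Learner V)
    (C : ℝ) (k : ℕ) (rbar η : ℝ) : Prop :=
  ∀ ε ∈ Set.Ioo (0 : ℝ) 1, ∀ δ ∈ Set.Ioo (0 : ℝ) 1, ∀ w ∈ W,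
    ∀ P : Measure (Set V), IsProbabilityMeasure P →
    ∀ r ∈ Set.Icc (rbar * (1 - η)) (rbar * (1 + η)), r ≤ 1 →
    ∀ M : ℕ, sampleBound C k (Fintype.card V) E.card ε δ r η ≤ M →
      sampleLaw Ω P M
        {x | ε + 4 * η ^ 2 / (1 - η) ^ 2 ≤
          sqErr P (model w) (L M fun i => incompleteCascade (model w) r (x i)) -
            sqErr P (model w) (influence (model w))} ≤ ENNReal.ofReal δ

end Diffusion

end

/-! The learner is approximate empirical risk minimization over the parameters. On a cascade `(S,
A)` it charges `F` the average over nodes of `F_v² - (2 / rbar) F_v 1[v ∈ A \ S]`, so neither the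
true retention rate nor the accuracy is needed.

Bias: let `p` be the true activation probability of a non-seed and `ρ = r / rbar`. The expected
excess charge there is `(f - ρp)² - (p - ρp)²`. Since `(f - p)² ≤ 2(f - ρp)² + 2(p - ρp)²`, the
squared error is at most twice the excess charge plus `4(ρ - 1)²p² ≤ 4η²`. At seeds both functions
equal 1. This is `excess_sqErr_le`.

Concentration: a process is determined by finitely many comparisons of a uniform variable with a
level depending on `w`. Running two parameter vectors on the same variables, they differ only if
some comparison flips, so influence is Lipschitz in `w` (`IsRegular`). Hoeffding and a union bound
over a net of the parameters then give uniform deviation bounds for the empirical charge. The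
Lipschitz constant `n 2ⁿ m` is exponential, but only its logarithm enters: about `n m log / (ε² r²)`
samples suffice, which is below the stated bound. -/

noncomputable section

namespace Diffusion

/-! ### Concentration, parameter nets and approximate minimizers. -/

/-- Hoeffding's inequality for the sample mean of a bounded function. -/
theorem hoeffding_sum_ge {X : Type*} [MeasurableSpace X] (μ : Measure X) [IsProbabilityMeasure μ]
    {g : X → ℝ} (hg : Measurable g) {B : ℝ} (hb : ∀ x, |g x| ≤ B) (M : ℕ) {t : ℝ} (ht : 0 ≤ t) :
    (Measure.pi fun _ : Fin M => μ).real {x | M * t ≤ ∑ j, (g (x j) - ∫ y, g y ∂μ)} ≤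
      Real.exp (-(M * t ^ 2) / (2 * B ^ 2)) := by
  have hsub : ProbabilityTheory.HasSubgaussianMGF (fun x => g x - ∫ y, g y ∂μ)
      ((‖B - -B‖₊ / 2) ^ 2) μ :=
    ProbabilityTheory.hasSubgaussianMGF_of_mem_Icc hg.aemeasurable
      (ae_of_all _ fun x => abs_le.1 (hb x))
  have hind : ProbabilityTheory.iIndepFun
      (fun (j : Fin M) (x : Fin M → X) => g (x j) - ∫ y, g y ∂μ) (Measure.pi fun _ => μ) :=
    ProbabilityTheory.iIndepFun_pi (X := fun _ x => g x - ∫ y, g y ∂μ)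
      (fun _ => (hg.sub_const _).aemeasurable)
  have hsub' : ∀ j ∈ (Finset.univ : Finset (Fin M)), ProbabilityTheory.HasSubgaussianMGF
      (fun x : Fin M → X => g (x j) - ∫ y, g y ∂μ) ((‖B - -B‖₊ / 2) ^ 2)
      (Measure.pi fun _ => μ) := by
    intro j _
    have hm := (measurePreserving_eval (fun _ : Fin M => μ) j)
    refine ProbabilityTheory.HasSubgaussianMGF.of_map (X := fun x => g x - ∫ y, g y ∂μ)
      hm.measurable.aemeasurable ?_
    rwa [hm.map_eq]
  refine (ProbabilityTheory.HasSubgaussianMGF.measure_sum_ge_le_of_iIndepFun hind hsub'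
    (by positivity)).trans_eq ?_
  congr 1
  -- Values range over an interval of length `2B`, so Hoeffding's lemma gives variance proxy `B²`.
  have : (‖B - -B‖ / 2) ^ 2 = B ^ 2 := by
    rw [Real.norm_eq_abs, div_pow, sq_abs]; ring
  simp only [Finset.sum_const, Finset.card_univ, Fintype.card_fin, nsmul_eq_mul, NNReal.coe_mul,
    NNReal.coe_natCast, NNReal.coe_pow, NNReal.coe_div, coe_nnnorm, NNReal.coe_ofNat, this]
  rcases Nat.eq_zero_or_pos M with rfl | hM
  · simp
  · have : (M : ℝ) ≠ 0 := by positivity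
    by_cases hB : B = 0
    · simp [hB]
    · field_simp

/-- Uniform deviation bound for the sample means of finitely many bounded functions. -/
theorem measure_exists_deviation_le {X : Type*} [MeasurableSpace X] (μ : Measure X)
    [IsProbabilityMeasure μ] {ι : Type*} [Fintype ι] {g : ι → X → ℝ} (hg : ∀ i, Measurable (g i))
    {B : ℝ} (hb : ∀ i x, |g i x| ≤ B) (M : ℕ) {t : ℝ} (ht : 0 ≤ t) :
    (Measure.pi fun _ : Fin M => μ).real
        {x | ∃ i, M * t ≤ |∑ j, g i (x j) - M * ∫ y, g i y ∂μ|} ≤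
      Fintype.card ι * (2 * Real.exp (-(M * t ^ 2) / (2 * B ^ 2))) := by
  have hsum : ∀ i (x : Fin M → X),
      ∑ j, (g i (x j) - ∫ y, g i y ∂μ) = ∑ j, g i (x j) - M * ∫ y, g i y ∂μ := by
    intro i x; simp [Finset.sum_sub_distrib]
  have hset : {x : Fin M → X | ∃ i, M * t ≤ |∑ j, g i (x j) - M * ∫ y, g i y ∂μ|} ⊆
      ⋃ i ∈ (Finset.univ : Finset ι), ({x | M * t ≤ ∑ j, (g i (x j) - ∫ y, g i y ∂μ)} ∪
        {x | M * t ≤ ∑ j, ((-g i) (x j) - ∫ y, (-g i) y ∂μ)}) := by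
    rintro x ⟨i, hi⟩
    simp only [Set.mem_iUnion, Finset.mem_univ, exists_true_left]
    refine ⟨i, ?_⟩
    rcases le_abs.1 hi with h | h
    · left; simpa only [Set.mem_ofPred_eq, hsum] using h
    · right
      have : ∑ j, ((-g i) (x j) - ∫ y, (-g i) y ∂μ) =
          -(∑ j, g i (x j) - M * ∫ y, g i y ∂μ) := by
        simp only [Pi.neg_apply, integral_neg, ← hsum, ← Finset.sum_neg_distrib]
        exact Finset.sum_congr rfl fun j _ => by ring
      simpa only [Set.mem_ofPred_eq, this] using h
  refine (measureReal_mono hset (measure_ne_top _ _)).trans ((measureReal_biUnion_finset_le _ _).trans ?_)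
  refine (Finset.sum_le_card_nsmul _ _ (2 * Real.exp (-(M * t ^ 2) / (2 * B ^ 2)))
    fun i _ => ?_).trans_eq (by rw [nsmul_eq_mul, Finset.card_univ])
  refine (measureReal_union_le _ _).trans ?_
  rw [two_mul]
  exact add_le_add (hoeffding_sum_ge μ (hg i) (hb i) M ht)
    (hoeffding_sum_ge μ (hg i).neg (fun x => by simpa using hb i x) M ht)

/-- A finite internal net of a set of vectors in the unit cube. -/
theorem exists_finite_net {ι : Type*} [Fintype ι] {W : Set (ι → ℝ)} (hne : W.Nonempty)
    (hW : ∀ w ∈ W, ∀ e, w e ∈ Set.Icc (0 : ℝ) 1) {K : ℕ} (hK : 0 < K) :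
    ∃ c : (ι → Fin (K + 1)) → ι → ℝ, (∀ a, c a ∈ W) ∧
      ∀ w ∈ W, ∃ a, ∀ e, |w e - c a e| ≤ 1 / K := by
  classical
  have hKr : (0 : ℝ) < K := by exact_mod_cast hK
  -- Grid cells of side `1 / K`. Coordinate 1 gets index `K`, hence `K + 1` indices, and the
  -- reduction in `Fin.ofNat` never acts on `W`.
  let cell : (ι → ℝ) → ι → Fin (K + 1) := fun w e => Fin.ofNat (K + 1) ⌊K * w e⌋₊
  have hcell : ∀ w ∈ W, ∀ e, ((cell w e : ℕ)) = ⌊K * w e⌋₊ := by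
    intro w hw e
    refine Nat.mod_eq_of_lt (Nat.lt_succ_of_le (Nat.floor_le_of_le ?_))
    have := (hW w hw e).2
    nlinarith
  obtain ⟨w₀, hw₀⟩ := hne
  -- Each cell meeting `W` is represented by one of its points in `W`; other cells get the dummy
  -- `w₀`.
  refine ⟨fun a => if h : ∃ w ∈ W, cell w = a then h.choose else w₀, fun a => ?_,
    fun w hw => ⟨cell w, fun e => ?_⟩⟩
  · dsimp only
    split_ifs with h
    · exact h.choose_spec.1
    · exact hw₀
  · have h : ∃ w' ∈ W, cell w' = cell w := ⟨w, hw, rfl⟩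
    simp only [h, dite_true]
    set w' := h.choose
    have hw' : w' ∈ W := h.choose_spec.1
    have heq : ⌊K * w e⌋₊ = ⌊K * w' e⌋₊ := by
      rw [← hcell w hw, ← hcell w' hw', h.choose_spec.2]
    have h1 := Nat.floor_le (mul_nonneg hKr.le (hW w hw e).1)
    have h2 := Nat.lt_floor_add_one (K * w e)
    have h3 := Nat.floor_le (mul_nonneg hKr.le (hW w' hw' e).1)
    have h4 := Nat.lt_floor_add_one (K * w' e)
    rw [heq] at h1 h2
    rw [abs_le]
    constructor <;> rw [← mul_le_mul_iff_right₀ hKr] <;> field_simp <;> linarith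

/-- Working with the infimum avoids any question of attainment. The slack is a fixed 1 because the
learner does not know `ε`; on a total over `M` samples it costs only `1 / M` on average. -/
theorem exists_almost_minimizer {α : Type*} {W : Set α} (hne : W.Nonempty) {f : α → ℝ} {b : ℝ}
    (hb : ∀ w ∈ W, b ≤ f w) : ∃ w ∈ W, ∀ w' ∈ W, f w ≤ f w' + 1 := by
  have hbdd : BddBelow (f '' W) := ⟨b, by rintro _ ⟨w, hw, rfl⟩; exact hb w hw⟩
  obtain ⟨_, ⟨w, hw, rfl⟩, hlt⟩ :=
    exists_lt_of_csInf_lt (hne.image f) (lt_add_one (sInf (f '' W)))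
  refine ⟨w, hw, fun w' hw' => ?_⟩
  have := csInf_le hbdd ⟨w', hw', rfl⟩
  linarith

/-! ### Uniform variables, measurability and coupling. -/

instance discreteMeasurableSpace_set {V : Type u} [Finite V] :
    DiscreteMeasurableSpace (Set V) := by
  have : MeasurableSingletonClass (Set V) :=
    inferInstanceAs (MeasurableSingletonClass (V → Prop))
  infer_instance

theorem measurableSet_uniform_le {ι : Type*} (j : ι) (a : ℝ) :
    MeasurableSet {θ : ι → unitInterval | (θ j : ℝ) ≤ a} :=
  measurableSet_le (measurable_subtype_coe.comp (measurable_pi_apply j)) measurable_const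

theorem volume_uniform_le {ι : Type*} [Fintype ι] (j : ι) {a : ℝ} (ha : a ∈ Set.Icc (0 : ℝ) 1) :
    (volume : Measure (ι → unitInterval)).real {θ | (θ j : ℝ) ≤ a} = a := by
  have h := (measurePreserving_eval (fun _ : ι => (volume : Measure unitInterval)) j)
  have hs : {θ : ι → unitInterval | (θ j : ℝ) ≤ a} =
      Function.eval j ⁻¹' Set.Iic (⟨a, ha⟩ : unitInterval) := by
    ext θ; simp [← Subtype.coe_le_coe]
  rw [hs, volume_pi, h.measureReal_preimage measurableSet_Iic.nullMeasurableSet, Measure.real,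
    unitInterval.volume_Iic, ENNReal.toReal_ofReal ha.1]

/-- The comparisons disagree exactly when the variable lies in the half-open interval between `a`
and `b`. Only an inequality holds, since the levels may leave the unit interval. -/
theorem volume_uniform_between {ι : Type*} [Fintype ι] (j : ι) (a b : ℝ) :
    (volume : Measure (ι → unitInterval)).real {θ | ¬((θ j : ℝ) ≤ a ↔ (θ j : ℝ) ≤ b)} ≤
      |a - b| := by
  have h := (measurePreserving_eval (fun _ : ι => (volume : Measure unitInterval)) j)
  have hs : {θ : ι → unitInterval | ¬((θ j : ℝ) ≤ a ↔ (θ j : ℝ) ≤ b)} =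
      Function.eval j ⁻¹' ((↑) ⁻¹' Set.uIoc a b) := by
    ext θ
    simp only [Set.mem_ofPred_eq, Set.mem_preimage, Function.eval, Set.mem_uIoc]
    constructor
    · intro hn
      by_cases h1 : (θ j : ℝ) ≤ a
      · right; simp only [h1, true_iff, not_le] at hn; exact ⟨hn, h1⟩
      · left; simp only [h1, false_iff, not_not] at hn; exact ⟨not_le.1 h1, hn⟩
    · rintro (⟨h1, h2⟩ | ⟨h1, h2⟩) hn
      · exact absurd (hn.2 h2) (not_le.2 h1)
      · exact absurd (hn.1 h2) (not_le.2 h1)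
  have hm : MeasurableSet ((↑) ⁻¹' Set.uIoc a b : Set unitInterval) :=
    measurable_subtype_coe measurableSet_uIoc
  rw [hs, volume_pi, h.measureReal_preimage hm.nullMeasurableSet, Measure.real,
    unitInterval.volume_apply]
  refine ENNReal.toReal_le_of_le_ofReal (abs_nonneg _) ?_
  refine (measure_mono (Set.image_preimage_subset _ _)).trans ?_
  rw [Real.volume_uIoc, abs_sub_comm]

theorem dicState_congr {V : Type u} {E : Finset (V × V)} {w w' : E → ℝ} {U U' : E → unitInterval}
    (h : ∀ e, (U e : ℝ) ≤ w e ↔ (U' e : ℝ) ≤ w' e) (S : Set V) (t : ℕ) :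
    dicState w S U t = dicState w' S U' t := by
  induction t with
  | zero => rfl
  | succ t ih => simp only [dicState, ih, h]

theorem dicFinal_congr {V : Type u} {E : Finset (V × V)} {w w' : E → ℝ} {U U' : E → unitInterval}
    (h : ∀ e, (U e : ℝ) ≤ w e ↔ (U' e : ℝ) ≤ w' e) (S : Set V) :
    dicFinal w S U = dicFinal w' S U' := by
  simp only [dicFinal, dicState_congr h]

theorem dltState_congr {V : Type u} {E : Finset (V × V)} {w w' : E → ℝ} {θ θ' : V → unitInterval}
    (h : ∀ p : V × Set V, (θ p.1 : ℝ) ≤ inWeight w p.2 p.1 ↔ (θ' p.1 : ℝ) ≤ inWeight w' p.2 p.1)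
    (S : Set V) (t : ℕ) : dltState w S θ t = dltState w' S θ' t := by
  induction t with
  | zero => rfl
  | succ t ih =>
    simp only [dltState, ih]
    congr 1
    ext v
    exact h (v, _)

theorem dltFinal_congr {V : Type u} {E : Finset (V × V)} {w w' : E → ℝ} {θ θ' : V → unitInterval}
    (h : ∀ p : V × Set V, (θ p.1 : ℝ) ≤ inWeight w p.2 p.1 ↔ (θ' p.1 : ℝ) ≤ inWeight w' p.2 p.1)
    (S : Set V) : dltFinal w S θ = dltFinal w' S θ' := by
  simp only [dltFinal, dltState_congr h]

theorem abs_inWeight_sub_le {V : Type u} {E : Finset (V × V)} {w w' : E → ℝ} {d : ℝ}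
    (h : ∀ e, |w e - w' e| ≤ d) (A : Set V) (v : V) :
    |inWeight w A v - inWeight w' A v| ≤ E.card * d := by
  have hcard : (E.card : ℝ) * d = ∑ _e : E, d := by simp
  rw [inWeight, inWeight, ← Finset.sum_sub_distrib, hcard]
  refine (Finset.abs_sum_le_sum_abs _ _).trans (Finset.sum_le_sum fun e _ => ?_)
  have hd : 0 ≤ d := (abs_nonneg _).trans (h e)
  by_cases he : e.1.2 = v ∧ e.1.1 ∈ A
  · simpa [Set.indicator, he] using h e
  · simpa [Set.indicator, he] using hd

/-- If the final active set is determined by finitely many events, each of which compares one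
uniform variable with a level, then activation events are measurable. -/
theorem measurableSet_active {V : Type u} {ι J : Type*} [Finite J]
    (act : (ι → unitInterval) → Set V) (idx : J → ι) (level : J → ℝ)
    (h : ∀ θ θ', (∀ j, (θ (idx j) : ℝ) ≤ level j ↔ (θ' (idx j) : ℝ) ≤ level j) → act θ = act θ')
    (v : V) : MeasurableSet {θ | v ∈ act θ} := by
  let pat : (ι → unitInterval) → Set J := fun θ => {j | (θ (idx j) : ℝ) ≤ level j}
  have hpat : Measurable pat := measurable_set_iff.2 fun j =>
    measurableSet_setOfPred.1 (measurableSet_uniform_le (idx j) (level j))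
  -- The event is a union of fibres of `pat`, which takes finitely many values.
  have : {θ | v ∈ act θ} = pat ⁻¹' (pat '' {θ | v ∈ act θ}) := by
    refine (Set.subset_preimage_image _ _).antisymm ?_
    rintro θ ⟨θ', hθ', heq⟩
    have : act θ' = act θ := h θ' θ fun j => (Set.ext_iff.1 heq j)
    simpa [this] using hθ'
  rw [this]
  exact hpat (Set.toFinite _).measurableSet

/-- Coupling bound: two processes that are driven by the same uniform variables and agree as soon
as all comparisons with their levels agree have close activation probabilities. -/
theorem abs_volume_active_sub_le {V : Type u} {ι J : Type*} [Fintype ι] [Fintype J]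
    (act act' : (ι → unitInterval) → Set V) (idx : J → ι) (level level' : J → ℝ)
    (h : ∀ θ, (∀ j, (θ (idx j) : ℝ) ≤ level j ↔ (θ (idx j) : ℝ) ≤ level' j) → act θ = act' θ)
    {d : ℝ} (hd : ∀ j, |level j - level' j| ≤ d) (v : V) :
    |(volume : Measure (ι → unitInterval)).real {θ | v ∈ act θ} -
      (volume : Measure (ι → unitInterval)).real {θ | v ∈ act' θ}| ≤ Fintype.card J * d := by
  set D : Set (ι → unitInterval) :=
    ⋃ j ∈ (Finset.univ : Finset J),
      {θ | ¬((θ (idx j) : ℝ) ≤ level j ↔ (θ (idx j) : ℝ) ≤ level' j)} with hD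
  have hDle : (volume : Measure (ι → unitInterval)).real D ≤ Fintype.card J * d := by
    refine (measureReal_biUnion_finset_le _ _).trans ?_
    rw [← Finset.card_univ, ← nsmul_eq_mul]
    exact Finset.sum_le_card_nsmul _ _ _ fun j _ =>
      (volume_uniform_between _ _ _).trans (hd j)
  have hout : ∀ θ, θ ∉ D → act θ = act' θ := by
    intro θ hθ
    refine h θ fun j => ?_
    simp only [hD, Set.mem_iUnion, Finset.mem_univ, exists_true_left, not_exists,
      Set.mem_ofPred_eq, not_not] at hθ
    exact hθ j
  have key : ∀ A B : Set (ι → unitInterval), A ⊆ B ∪ D →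
      (volume : Measure (ι → unitInterval)).real A -
        (volume : Measure (ι → unitInterval)).real B ≤ Fintype.card J * d := by
    intro A B hAB
    have := (measureReal_mono (μ := (volume : Measure (ι → unitInterval))) hAB).trans
      (measureReal_union_le B D)
    linarith
  rw [abs_sub_le_iff]
  constructor <;> refine key _ _ fun θ hθ => ?_ <;> by_cases hmem : θ ∈ D
  · exact Or.inr hmem
  · exact Or.inl (by simpa [hout θ hmem] using hθ)
  · exact Or.inr hmem
  · exact Or.inl (by simpa [hout θ hmem] using hθ)

/-! ### Regularity of the two models. -/

/-- The properties of a diffusion model that learning relies on. -/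
structure IsRegular {V : Type u} [Fintype V] {Ω : Type u} [MeasureSpace Ω] {E : Finset (V × V)}
    (model : (E → ℝ) → Set V → Ω → Set V) : Prop where
  measurableSet_mem : ∀ w S v, MeasurableSet {ω | v ∈ model w S ω}
  seeds_subset : ∀ w S ω, S ⊆ model w S ω
  influence_lipschitz : ∀ (w w' : E → ℝ) (d : ℝ), (∀ e, |w e - w' e| ≤ d) → 0 ≤ d → ∀ S v,
    |influence (model w) S v - influence (model w') S v| ≤
      (Fintype.card V * 2 ^ Fintype.card V) * (E.card * d)

theorem isRegular_dicFinal {V : Type u} [Fintype V] (E : Finset (V × V)) :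
    IsRegular (dicFinal (E := E)) where
  measurableSet_mem w S v :=
    measurableSet_active (fun U => dicFinal w S U) id w (fun _ _ h => dicFinal_congr h S) v
  seeds_subset w S U := Set.subset_iUnion (fun t => (dicState w S U t).1) 0
  influence_lipschitz w w' d h hd S v := by
    refine (abs_volume_active_sub_le (fun U => dicFinal w S U) (fun U => dicFinal w' S U)
      id w w' (fun _ h => dicFinal_congr h S) h v).trans ?_
    have : 1 ≤ Fintype.card V * 2 ^ Fintype.card V :=
      Nat.mul_pos (Fintype.card_pos_iff.2 ⟨v⟩) (by positivity)
    rw [Fintype.card_coe]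
    exact le_mul_of_one_le_left (by positivity) (by exact_mod_cast this)

/-- The levels are the incoming weights of all pairs of a node and an active set: `n 2ⁿ` levels,
each moving by at most `m d`. This case dictates the constant in `IsRegular`; for cascades the `m`
edge parameters are the levels. -/
theorem isRegular_dltFinal {V : Type u} [Fintype V] (E : Finset (V × V)) :
    IsRegular (dltFinal (E := E)) where
  measurableSet_mem w S v :=
    measurableSet_active (J := V × Set V) (fun θ => dltFinal w S θ) Prod.fst
      (fun p => inWeight w p.2 p.1) (fun _ _ h => dltFinal_congr h S) v
  seeds_subset w S θ := Set.subset_iUnion (fun t => dltState w S θ t) 0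
  influence_lipschitz w w' d h hd S v := by
    classical
    refine (abs_volume_active_sub_le (J := V × Set V) (fun θ => dltFinal w S θ)
      (fun θ => dltFinal w' S θ) Prod.fst (fun p => inWeight w p.2 p.1)
      (fun p => inWeight w' p.2 p.1) (fun _ h => dltFinal_congr h S)
      (fun p => abs_inWeight_sub_le h p.2 p.1) v).trans_eq ?_
    simp

/-! ### Expected losses and the bias from the unknown rate. -/

/-- Fubini for integrands affine in the membership indicators, the form taken by both the squared
error and the cascade loss. -/
theorem integral_average_membership {V : Type u} [Fintype V] {Ω : Type*} [MeasurableSpace Ω]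
    (P : Measure (Set V)) [IsProbabilityMeasure P] (ν : Measure Ω) [IsProbabilityMeasure ν]
    {A : Set V → Ω → Set V} (hA : ∀ S v, MeasurableSet {ω | v ∈ A S ω}) (a b : Set V → V → ℝ) :
    ∫ x, (1 / (Fintype.card V : ℝ)) *
        ∑ v, (a x.1 v + b x.1 v * Set.indicator (A x.1 x.2) 1 v) ∂(P.prod ν) =
      ∫ S, (1 / (Fintype.card V : ℝ)) *
        ∑ v, (a S v + b S v * ν.real {ω | v ∈ A S ω}) ∂P := by
  have hind : ∀ S v, (fun ω => Set.indicator (A S ω) (1 : V → ℝ) v) =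
      Set.indicator {ω | v ∈ A S ω} 1 := by
    intro S v; ext ω; simp [Set.indicator]
  have hint : ∀ S v, Integrable (fun ω => Set.indicator (A S ω) (1 : V → ℝ) v) ν := by
    intro S v
    rw [hind]
    exact (integrable_const 1).indicator (hA S v)
  have hmeas : Measurable (fun x : Set V × Ω => (1 / (Fintype.card V : ℝ)) *
      ∑ v, (a x.1 v + b x.1 v * Set.indicator (A x.1 x.2) 1 v)) := by
    refine measurable_from_prod_countable_right fun S => ?_
    refine (Finset.measurable_sum _ fun v _ => ?_).const_mul _
    have h1 : Measurable fun ω => Set.indicator (A S ω) (1 : V → ℝ) v := by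
      rw [hind]
      exact measurable_const.indicator (hA S v)
    exact (h1.const_mul (b S v)).const_add (a S v)
  have hbdd : Integrable (fun x : Set V × Ω => (1 / (Fintype.card V : ℝ)) *
      ∑ v, (a x.1 v + b x.1 v * Set.indicator (A x.1 x.2) 1 v)) (P.prod ν) := by
    obtain ⟨C, hC⟩ := (Set.finite_range fun S : Set V => ‖1 / (Fintype.card V : ℝ)‖ *
      ∑ v, (‖a S v‖ + ‖b S v‖)).bddAbove
    refine Integrable.of_bound hmeas.aestronglyMeasurable C (ae_of_all _ fun x => ?_)
    refine le_trans ?_ (hC ⟨x.1, rfl⟩)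
    rw [norm_mul]
    refine mul_le_mul_of_nonneg_left ?_ (norm_nonneg _)
    refine (norm_sum_le _ _).trans (Finset.sum_le_sum fun v _ => ?_)
    refine (norm_add_le _ _).trans (add_le_add le_rfl ?_)
    rw [norm_mul]
    refine mul_le_of_le_one_right (norm_nonneg _) ?_
    by_cases h : v ∈ A x.1 x.2 <;> simp [h]
  rw [integral_prod _ hbdd]
  refine integral_congr_ae (ae_of_all _ fun S => ?_)
  dsimp only
  rw [integral_const_mul, integral_finsetSum]
  swap
  · exact fun v _ => (integrable_const _).add ((hint S v).const_mul _)
  congr 1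
  refine Finset.sum_congr rfl fun v _ => ?_
  rw [integral_add (integrable_const _) ((hint S v).const_mul _), integral_const_mul, hind,
    integral_indicator_one (hA S v)]
  simp

theorem influence_mem_Icc {V : Type u} {Ω : Type u} [MeasureSpace Ω]
    [IsProbabilityMeasure (volume : Measure Ω)] (act : Set V → Ω → Set V) (S : Set V) (v : V) :
    influence act S v ∈ Set.Icc (0 : ℝ) 1 :=
  ⟨measureReal_nonneg, measureReal_le_one⟩

theorem influence_eq_one_of_mem {V : Type u} {Ω : Type u} [MeasureSpace Ω]
    [IsProbabilityMeasure (volume : Measure Ω)] {act : Set V → Ω → Set V}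
    (h : ∀ S ω, S ⊆ act S ω) {S : Set V} {v : V} (hv : v ∈ S) : influence act S v = 1 := by
  have : {ω | v ∈ act S ω} = Set.univ := Set.eq_univ_of_forall fun ω => h S ω hv
  simp [influence, this]

/-- The excess squared error is the mean quadratic distance to the true influence function. -/
theorem sqErr_sub_sqErr_influence {V : Type u} [Fintype V] {Ω : Type u} [MeasureSpace Ω]
    [IsProbabilityMeasure (volume : Measure Ω)] (P : Measure (Set V)) [IsProbabilityMeasure P]
    {act : Set V → Ω → Set V} (hact : ∀ S v, MeasurableSet {ω | v ∈ act S ω})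
    (F : Set V → V → ℝ) :
    sqErr P act F - sqErr P act (influence act) = ∫ S, sqLoss (F S) (influence act S) ∂P := by
  -- An indicator equals its square, which makes the quadratic loss affine in it.
  have key : ∀ F : Set V → V → ℝ, sqErr P act F = ∫ S, (1 / (Fintype.card V : ℝ)) *
      ∑ v, (F S v ^ 2 + (1 - 2 * F S v) * influence act S v) ∂P := by
    intro F
    rw [sqErr]
    refine Eq.trans ?_ (integral_average_membership P volume hact (fun S v => F S v ^ 2)
      (fun S v => 1 - 2 * F S v))
    refine integral_congr_ae (ae_of_all _ fun x => ?_)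
    simp only [sqLoss]
    congr 1
    refine Finset.sum_congr rfl fun v _ => ?_
    by_cases h : v ∈ act x.1 x.2 <;> simp [h]
    ring
  rw [key, key, ← integral_sub Integrable.of_finite Integrable.of_finite]
  refine integral_congr_ae (ae_of_all _ fun S => ?_)
  simp only [sqLoss]
  rw [← mul_sub, ← Finset.sum_sub_distrib]
  congr 1
  exact Finset.sum_congr rfl fun v _ => by ring

/-- The loss of the influence function `F` on an incomplete cascade: up to a term that does not
depend on `F`, the quadratic loss of `F` for the observed activations divided by the nominal
retention rate. -/
def cascadeLoss {V : Type u} [Fintype V] (rbar : ℝ) (F : Set V → V → ℝ) (x : Set V × Set V) : ℝ :=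
  (1 / (Fintype.card V : ℝ)) *
    ∑ v, (F x.1 v ^ 2 + -(2 / rbar * F x.1 v) * Set.indicator (x.2 \ x.1) 1 v)

/-- Activation and retention are independent, so their probabilities multiply. Seeds are removed
because they are observed whatever the rate. -/
theorem volume_observed {V : Type u} [Fintype V] {Ω : Type u} [MeasureSpace Ω]
    [IsProbabilityMeasure (volume : Measure Ω)] (act : Set V → Ω → Set V) {r : ℝ}
    (hr : r ∈ Set.Icc (0 : ℝ) 1) (S : Set V) (v : V) :
    ((volume : Measure Ω).prod (volume : Measure (V → unitInterval))).real
      {z | v ∈ {v | v ∈ act S z.1 \ S ∧ (z.2 v : ℝ) ≤ r}} =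
    r * Set.indicator Sᶜ (influence act S) v := by
  by_cases hv : v ∈ S
  · simp [hv]
  · have : {z : Ω × (V → unitInterval) | v ∈ {v | v ∈ act S z.1 \ S ∧ (z.2 v : ℝ) ≤ r}} =
        {ω | v ∈ act S ω} ×ˢ {R | (R v : ℝ) ≤ r} := by
      ext z; simp [hv]
    rw [this, measureReal_prod_prod, volume_uniform_le v hr, mul_comm]
    simp [hv, influence]

theorem measurableSet_observed {V : Type u} [Fintype V] {Ω : Type u} [MeasureSpace Ω]
    {act : Set V → Ω → Set V} (hact : ∀ S v, MeasurableSet {ω | v ∈ act S ω}) (r : ℝ)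
    (S : Set V) (v : V) :
    MeasurableSet {z : Ω × (V → unitInterval) |
      v ∈ {v | v ∈ act S z.1 \ S ∧ (z.2 v : ℝ) ≤ r}} := by
  have : {z : Ω × (V → unitInterval) | v ∈ {v | v ∈ act S z.1 \ S ∧ (z.2 v : ℝ) ≤ r}} =
      {ω | v ∈ act S ω \ S} ×ˢ {R | (R v : ℝ) ≤ r} := by
    ext z; simp
  rw [this]
  exact ((hact S v).diff (MeasurableSet.const (v ∈ S))).prod (measurableSet_uniform_le v r)

theorem measurable_incompleteCascade {V : Type u} [Fintype V] {Ω : Type u} [MeasureSpace Ω]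
    {act : Set V → Ω → Set V} (hact : ∀ S v, MeasurableSet {ω | v ∈ act S ω}) (r : ℝ) :
    Measurable (incompleteCascade act r) := by
  refine measurable_fst.prodMk (measurable_set_iff.2 fun v => ?_)
  refine measurable_from_prod_countable_right fun S => ?_
  refine measurableSet_setOfPred.1 ?_
  exact (MeasurableSet.const (v ∈ S)).union (measurableSet_observed hact r S v)

theorem integral_cascadeLoss {V : Type u} [Fintype V] {Ω : Type u} [MeasureSpace Ω]
    [IsProbabilityMeasure (volume : Measure Ω)] (P : Measure (Set V)) [IsProbabilityMeasure P]
    {act : Set V → Ω → Set V} (hact : ∀ S v, MeasurableSet {ω | v ∈ act S ω}) {r : ℝ}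
    (hr : r ∈ Set.Icc (0 : ℝ) 1) (rbar : ℝ) (F : Set V → V → ℝ) :
    ∫ x, cascadeLoss rbar F (incompleteCascade act r x)
        ∂(P.prod ((volume : Measure Ω).prod (volume : Measure (V → unitInterval)))) =
      ∫ S, (1 / (Fintype.card V : ℝ)) * ∑ v, (F S v ^ 2 +
        -(2 / rbar * F S v) * (r * Set.indicator Sᶜ (influence act S) v)) ∂P := by
  have h := integral_average_membership P
    ((volume : Measure Ω).prod (volume : Measure (V → unitInterval)))
    (A := fun S z => {v | v ∈ act S z.1 \ S ∧ (z.2 v : ℝ) ≤ r})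
    (measurableSet_observed hact r) (fun S v => F S v ^ 2) (fun S v => -(2 / rbar * F S v))
  simp only [volume_observed act hr] at h
  rw [← h]
  refine integral_congr_ae (ae_of_all _ fun x => ?_)
  have hset : (x.1 ∪ {v | v ∈ act x.1 x.2.1 \ x.1 ∧ (x.2.2 v : ℝ) ≤ r}) \ x.1 =
      {v | v ∈ act x.1 x.2.1 \ x.1 ∧ (x.2.2 v : ℝ) ≤ r} := by
    ext v; simp only [Set.mem_sdiff, Set.mem_union, Set.mem_ofPred_eq]; tauto
  simp only [cascadeLoss, incompleteCascade, hset]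

/-- The excess squared error is controlled by the excess of the expected loss on incomplete
cascades, up to the bias caused by the unknown retention rate. -/
theorem excess_sqErr_le {V : Type u} [Fintype V] {Ω : Type u} [MeasureSpace Ω]
    [IsProbabilityMeasure (volume : Measure Ω)] (P : Measure (Set V)) [IsProbabilityMeasure P]
    {act : Set V → Ω → Set V} (hact : ∀ S v, MeasurableSet {ω | v ∈ act S ω})
    (hseed : ∀ S ω, S ⊆ act S ω) {r rbar η : ℝ} (hr : r ∈ Set.Icc (0 : ℝ) 1)
    (hrate : |r / rbar - 1| ≤ η) {F : Set V → V → ℝ} (hF : ∀ S, ∀ v ∈ S, F S v = 1) :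
    sqErr P act F - sqErr P act (influence act) ≤
      2 * (∫ x, cascadeLoss rbar F (incompleteCascade act r x)
            ∂(P.prod ((volume : Measure Ω).prod (volume : Measure (V → unitInterval)))) -
          ∫ x, cascadeLoss rbar (influence act) (incompleteCascade act r x)
            ∂(P.prod ((volume : Measure Ω).prod (volume : Measure (V → unitInterval))))) +
        4 * η ^ 2 := by
  rw [sqErr_sub_sqErr_influence P hact, integral_cascadeLoss P hact hr,
    integral_cascadeLoss P hact hr, ← integral_sub Integrable.of_finite Integrable.of_finite,
    ← integral_const_mul]
  have hconst : 4 * η ^ 2 = ∫ _S : Set V, 4 * η ^ 2 ∂P := by simp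
  rw [hconst, ← integral_add Integrable.of_finite Integrable.of_finite]
  refine integral_mono Integrable.of_finite Integrable.of_finite fun S => ?_
  dsimp only [sqLoss]
  rw [← mul_sub, ← Finset.sum_sub_distrib]
  have hη2 : (r / rbar - 1) ^ 2 ≤ η ^ 2 := by
    rw [← sq_abs]; exact pow_le_pow_left₀ (abs_nonneg _) hrate 2
  have hpt : ∑ v, (F S v - influence act S v) ^ 2 ≤
      2 * ∑ v, (F S v ^ 2 + -(2 / rbar * F S v) * (r * Set.indicator Sᶜ (influence act S) v) -
        (influence act S v ^ 2 + -(2 / rbar * influence act S v) *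
          (r * Set.indicator Sᶜ (influence act S) v))) + Fintype.card V * (4 * η ^ 2) := by
    have : (Fintype.card V : ℝ) * (4 * η ^ 2) = ∑ _v : V, 4 * η ^ 2 := by simp
    rw [this, Finset.mul_sum, ← Finset.sum_add_distrib]
    refine Finset.sum_le_sum fun v _ => ?_
    by_cases hv : v ∈ S
    · simp only [hF S v hv, influence_eq_one_of_mem hseed hv, Set.indicator, Set.mem_compl_iff, hv,
        not_true_eq_false, if_false]
      nlinarith [sq_nonneg η]
    · rw [Set.indicator_of_mem (show v ∈ Sᶜ from hv)]
      obtain ⟨h0, h1⟩ := influence_mem_Icc act S v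
      set p := influence act S v
      set f := F S v
      have hp : (r / rbar - 1) ^ 2 * p ^ 2 ≤ η ^ 2 := by
        have hp1 : p ^ 2 ≤ 1 := pow_le_one₀ h0 h1
        calc (r / rbar - 1) ^ 2 * p ^ 2 ≤ (r / rbar - 1) ^ 2 * 1 :=
              mul_le_mul_of_nonneg_left hp1 (sq_nonneg _)
          _ ≤ η ^ 2 := by rwa [mul_one]
      have e : 2 / rbar = 2 * rbar⁻¹ := by ring
      rw [e]
      rw [div_eq_mul_inv] at hp
      -- With `a = f - ρp` and `b = ρp - p`, the hint is `(a - b)² ≥ 0`, that is `(a + b)² ≤ 2a² +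
      -- 2b²`.
      nlinarith [sq_nonneg (f - 2 * (r * rbar⁻¹) * p + p)]
  rcases isEmpty_or_nonempty V with hV | hV
  · simp only [Finset.univ_eq_empty, Finset.sum_empty, mul_zero, zero_add]
    positivity
  · have hn : (0 : ℝ) < Fintype.card V := by exact_mod_cast Fintype.card_pos
    refine (mul_le_mul_of_nonneg_left hpt (by positivity)).trans_eq ?_
    rw [mul_add, mul_left_comm, ← mul_assoc (1 / (Fintype.card V : ℝ)), one_div,
      inv_mul_cancel₀ hn.ne', one_mul]

/-! ### Size and Lipschitz bounds for the cascade loss. -/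

theorem abs_average_le {V : Type u} [Fintype V] {f : V → ℝ} {c : ℝ} (hc : 0 ≤ c)
    (h : ∀ v, |f v| ≤ c) : |(1 / (Fintype.card V : ℝ)) * ∑ v, f v| ≤ c := by
  rw [abs_mul, abs_of_nonneg (by positivity : (0 : ℝ) ≤ 1 / (Fintype.card V : ℝ))]
  have hs : |∑ v, f v| ≤ Fintype.card V * c := by
    refine (Finset.abs_sum_le_sum_abs _ _).trans ?_
    refine (Finset.sum_le_card_nsmul _ _ c fun v _ => h v).trans_eq ?_
    rw [nsmul_eq_mul, Finset.card_univ]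
  rcases Nat.eq_zero_or_pos (Fintype.card V) with h0 | hpos
  · simpa [h0] using hc
  · have hn : (0 : ℝ) < Fintype.card V := by exact_mod_cast hpos
    rw [one_div_mul_eq_div, div_le_iff₀ hn]
    linarith

theorem abs_cascadeLoss_le {V : Type u} [Fintype V] {rbar : ℝ} (hrbar : 0 < rbar)
    {F : Set V → V → ℝ} (hF : ∀ S v, F S v ∈ Set.Icc (0 : ℝ) 1) (x : Set V × Set V) :
    |cascadeLoss rbar F x| ≤ 1 + 2 / rbar := by
  refine abs_average_le (by positivity) fun v => ?_
  obtain ⟨h0, h1⟩ := hF x.1 v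
  have h2 : 0 < 2 / rbar := by positivity
  have h3 : F x.1 v ^ 2 ≤ 1 := pow_le_one₀ h0 h1
  have h4 : 2 / rbar * F x.1 v ≤ 2 / rbar := mul_le_of_le_one_right h2.le h1
  have h5 : 0 ≤ 2 / rbar * F x.1 v := by positivity
  rw [abs_le]
  by_cases hv : v ∈ x.2 \ x.1
  · rw [Set.indicator_of_mem hv, Pi.one_apply]
    constructor <;> nlinarith [sq_nonneg (F x.1 v)]
  · rw [Set.indicator_of_notMem hv]
    constructor <;> nlinarith [sq_nonneg (F x.1 v)]

theorem abs_cascadeLoss_sub_le {V : Type u} [Fintype V] {rbar : ℝ} (hrbar : 0 < rbar)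
    {F F' : Set V → V → ℝ} (hF : ∀ S v, F S v ∈ Set.Icc (0 : ℝ) 1)
    (hF' : ∀ S v, F' S v ∈ Set.Icc (0 : ℝ) 1) {β : ℝ} (hβ0 : 0 ≤ β)
    (hβ : ∀ S v, |F S v - F' S v| ≤ β) (x : Set V × Set V) :
    |cascadeLoss rbar F x - cascadeLoss rbar F' x| ≤ 2 * (1 + 2 / rbar) * β := by
  rw [cascadeLoss, cascadeLoss, ← mul_sub, ← Finset.sum_sub_distrib]
  refine abs_average_le (by positivity) fun v => ?_
  obtain ⟨h0, h1⟩ := hF x.1 v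
  obtain ⟨h0', h1'⟩ := hF' x.1 v
  have h2 : 0 < 2 / rbar := by positivity
  have hi : Set.indicator (x.2 \ x.1) (1 : V → ℝ) v ∈ Set.Icc (0 : ℝ) 1 := by
    by_cases hv : v ∈ x.2 \ x.1 <;> simp [hv]
  set y := Set.indicator (x.2 \ x.1) (1 : V → ℝ) v
  have e : F x.1 v ^ 2 + -(2 / rbar * F x.1 v) * y - (F' x.1 v ^ 2 + -(2 / rbar * F' x.1 v) * y) =
      (F x.1 v + F' x.1 v - 2 / rbar * y) * (F x.1 v - F' x.1 v) := by ring
  rw [e, abs_mul]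
  refine mul_le_mul ?_ (hβ _ _) (abs_nonneg _) (by positivity)
  have h3 : 2 / rbar * y ≤ 2 / rbar := mul_le_of_le_one_right h2.le hi.2
  have h4 : 0 ≤ 2 / rbar * y := mul_nonneg h2.le hi.1
  rw [abs_le]
  constructor <;> linarith

/-! ### Sample size arithmetic. -/

/-- All factors dropped from the bound are at least 1, and the logarithm exceeds 1 since its
argument is at least 6. The constant is `140800 = 11 * 12800`: the exponent `11 n m` of
`net_failure_le` times the factor in `exp_neg_sample_le`. -/
theorem sampleBound_lower_bounds {n m : ℕ} (hn : 1 ≤ n) (hm : 1 ≤ m) {ε δ r η : ℝ}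
    (hε : ε ∈ Set.Ioo (0 : ℝ) 1) (hδ : δ ∈ Set.Ioo (0 : ℝ) 1) (hr : r ∈ Set.Ioc (0 : ℝ) 1)
    (hη : η ∈ Set.Ico (0 : ℝ) 1) {M : ℕ} (hM : sampleBound 150000 1 n m ε δ r η ≤ M) :
    6 ≤ n + m + 1 / ε + 1 / δ + 1 / r + 1 / (1 - η) ∧ 4 / ε < M ∧
      140800 * (n * m) * Real.log (n + m + 1 / ε + 1 / δ + 1 / r + 1 / (1 - η)) ≤
        M * ε ^ 2 * r ^ 2 := by
  obtain ⟨hε0, hε1⟩ := hε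
  obtain ⟨hδ0, hδ1⟩ := hδ
  obtain ⟨hr0, hr1⟩ := hr
  obtain ⟨hη0, hη1⟩ := hη
  have hη' : 0 < 1 - η := by linarith
  have hn' : (1 : ℝ) ≤ n := by exact_mod_cast hn
  have hm' : (1 : ℝ) ≤ m := by exact_mod_cast hm
  have iε : 1 ≤ 1 / ε := (one_le_div hε0).2 hε1.le
  have iδ : 1 ≤ 1 / δ := (one_le_div hδ0).2 hδ1.le
  have ir : 1 ≤ 1 / r := (one_le_div hr0).2 hr1
  have iη : 1 ≤ 1 / (1 - η) := (one_le_div hη').2 (by linarith)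
  set X : ℝ := n + m + 1 / ε + 1 / δ + 1 / r + 1 / (1 - η) with hX
  have hX6 : 6 ≤ X := by linarith
  have hlog : 1 ≤ Real.log X := by
    rw [Real.le_log_iff_exp_le (by linarith)]
    linarith [Real.exp_one_lt_d9]
  have hfrac : n * m / (ε ^ 2 * r ^ 2) ≤ (n : ℝ) ^ 3 * m / (ε ^ 4 * r ^ 4 * (1 - η) ^ 4) := by
    refine div_le_div₀ (by positivity) ?_ (by positivity) ?_
    · exact mul_le_mul_of_nonneg_right (le_self_pow₀ hn' (by norm_num)) (by linarith)
    · calc ε ^ 4 * r ^ 4 * (1 - η) ^ 4 ≤ ε ^ 4 * r ^ 4 * 1 := by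
            gcongr; exact pow_le_one₀ hη'.le (by linarith)
        _ ≤ ε ^ 2 * r ^ 2 := by
            rw [mul_one]
            exact mul_le_mul (pow_le_pow_of_le_one hε0.le hε1.le (by norm_num))
              (pow_le_pow_of_le_one hr0.le hr1 (by norm_num)) (by positivity) (by positivity)
  have hM' : 150000 * (n * m / (ε ^ 2 * r ^ 2)) * Real.log X ≤ M := by
    refine le_trans ?_ hM
    rw [sampleBound, pow_one, ← hX]
    gcongr
  have hnm : (1 : ℝ) ≤ n * m := one_le_mul_of_one_le_of_one_le hn' hm'
  have hmain : 150000 * (n * m) * Real.log X ≤ M * ε ^ 2 * r ^ 2 := by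
    calc 150000 * (n * m) * Real.log X =
          150000 * (n * m / (ε ^ 2 * r ^ 2)) * Real.log X * (ε ^ 2 * r ^ 2) := by field_simp
      _ ≤ M * (ε ^ 2 * r ^ 2) := by gcongr
      _ = M * ε ^ 2 * r ^ 2 := by ring
  refine ⟨hX6, ?_, ?_⟩
  · rw [div_lt_iff₀ hε0]
    have h1 : 150000 ≤ 150000 * (n * m) * Real.log X := by nlinarith
    have h2 : (M : ℝ) * ε ^ 2 * r ^ 2 ≤ M * ε := by
      have : ε ^ 2 * r ^ 2 ≤ ε := by
        have := pow_le_one₀ hr0.le hr1 (n := 2)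
        nlinarith [sq_nonneg ε]
      calc (M : ℝ) * ε ^ 2 * r ^ 2 = M * (ε ^ 2 * r ^ 2) := by ring
        _ ≤ M * ε := by gcongr
    linarith
  · refine le_trans ?_ hmain
    have : 0 ≤ (n * m) * Real.log X := by positivity
    nlinarith

theorem net_size_le {n m : ℕ} {ε r X : ℝ} (hn1 : 1 ≤ n) (hm1 : 1 ≤ m) (hε0 : 0 < ε) (hr0 : 0 < r)
    (iε : 1 ≤ 1 / ε) (ir : 1 ≤ 1 / r) (hX : 6 ≤ X) (hnX : (n : ℝ) ≤ X) (hmX : (m : ℝ) ≤ X)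
    (hεX : 1 / ε ≤ X) (hrX : 1 / r ≤ X) :
    (⌈320 * (n * m * 2 ^ n) / (ε * r)⌉₊ : ℝ) + 1 ≤ X ^ (9 * n) := by
  have hn : (1 : ℝ) ≤ n := by exact_mod_cast hn1
  have hm : (1 : ℝ) ≤ m := by exact_mod_cast hm1
  have hX0 : 0 ≤ X := by linarith
  have h1 := (Nat.ceil_lt_add_one
    (by positivity : (0 : ℝ) ≤ 320 * (n * m * 2 ^ n) / (ε * r))).le
  have h2 : 320 * (n * m * 2 ^ n) / (ε * r) = 320 * (n * m * 2 ^ n * (1 / ε) * (1 / r)) := by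
    field_simp
  have h3 : 1 ≤ (n : ℝ) * m * 2 ^ n * (1 / ε) * (1 / r) :=
    one_le_mul_of_one_le_of_one_le (one_le_mul_of_one_le_of_one_le
      (one_le_mul_of_one_le_of_one_le (one_le_mul_of_one_le_of_one_le hn hm)
        (one_le_pow₀ one_le_two)) iε) ir
  have h4 : (322 : ℝ) ≤ X ^ 4 :=
    le_trans (by norm_num) (pow_le_pow_left₀ (by norm_num : (0 : ℝ) ≤ 6) hX 4)
  have h5 : (2 : ℝ) ^ n ≤ X ^ n := pow_le_pow_left₀ zero_le_two (by linarith) n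
  have h6 : (n : ℝ) * m * 2 ^ n * (1 / ε) * (1 / r) ≤ X * X * X ^ n * X * X := by gcongr
  calc (⌈320 * (n * m * 2 ^ n) / (ε * r)⌉₊ : ℝ) + 1
      ≤ 322 * (n * m * 2 ^ n * (1 / ε) * (1 / r)) := by rw [h2] at h1 ⊢; linarith
    _ ≤ X ^ 4 * (X * X * X ^ n * X * X) := mul_le_mul h4 h6 (by linarith) (by positivity)
    _ = X ^ (8 + n) := by ring
    _ ≤ X ^ (9 * n) := pow_le_pow_right₀ (by linarith) (by omega)

theorem exp_neg_sample_le {M k : ℕ} {ε r X B : ℝ} (hr0 : 0 < r) (hX : 1 ≤ X) (hB0 : 0 < B)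
    (hB : B ≤ 5 / r) (hM : 12800 * k * Real.log X ≤ M * ε ^ 2 * r ^ 2) :
    Real.exp (-(M * (ε / 16) ^ 2) / (2 * B ^ 2)) ≤ (X ^ k)⁻¹ := by
  have hX0 : 0 < X := by linarith
  have hl : 0 ≤ Real.log X := Real.log_nonneg hX
  have hB2 : B ^ 2 ≤ 25 / r ^ 2 := by
    refine (pow_le_pow_left₀ hB0.le hB 2).trans_eq ?_
    rw [div_pow]; norm_num
  have hle : k * Real.log X ≤ (M * (ε / 16) ^ 2) / (2 * B ^ 2) := by
    rw [le_div_iff₀ (by positivity)]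
    calc k * Real.log X * (2 * B ^ 2) ≤ k * Real.log X * (2 * (25 / r ^ 2)) := by gcongr
      _ = (12800 * k * Real.log X) / (256 * r ^ 2) := by field_simp; ring
      -- Here `12800 = 16² * 2 * 25`, from deviation `ε / 16` and `B ≤ 5 / r`.
      _ ≤ (M * ε ^ 2 * r ^ 2) / (256 * r ^ 2) := by gcongr
      _ = M * (ε / 16) ^ 2 := by field_simp; norm_num
  rw [← Real.exp_log (pow_pos hX0 k), ← Real.exp_neg, Real.exp_le_exp, Real.log_pow, neg_div]
  exact neg_le_neg hle

theorem net_failure_le {n m : ℕ} (hn : 1 ≤ n) (hm : 1 ≤ m) {ε δ r η : ℝ}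
    (hε : ε ∈ Set.Ioo (0 : ℝ) 1) (hδ : δ ∈ Set.Ioo (0 : ℝ) 1) (hr : r ∈ Set.Ioc (0 : ℝ) 1)
    (hη : η ∈ Set.Ico (0 : ℝ) 1) {M : ℕ} (hM : sampleBound 150000 1 n m ε δ r η ≤ M)
    {B : ℝ} (hB0 : 0 < B) (hB : B ≤ 5 / r) :
    ((⌈320 * (n * m * 2 ^ n) / (ε * r)⌉₊ : ℝ) + 1) ^ m *
      (2 * Real.exp (-(M * (ε / 16) ^ 2) / (2 * B ^ 2))) ≤ δ := by
  obtain ⟨hX6, -, hMX⟩ := sampleBound_lower_bounds hn hm hε hδ hr hη hM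
  have hn' : (1 : ℝ) ≤ n := by exact_mod_cast hn
  have hm' : (1 : ℝ) ≤ m := by exact_mod_cast hm
  have iε : 1 ≤ 1 / ε := (one_le_div hε.1).2 hε.2.le
  have iδ : 1 ≤ 1 / δ := (one_le_div hδ.1).2 hδ.2.le
  have ir : 1 ≤ 1 / r := (one_le_div hr.1).2 hr.2
  have iη : 1 ≤ 1 / (1 - η) := (one_le_div (by linarith [hη.2])).2 (by linarith [hη.1])
  obtain ⟨X, hX⟩ : ∃ X : ℝ, X = n + m + 1 / ε + 1 / δ + 1 / r + 1 / (1 - η) := ⟨_, rfl⟩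
  rw [← hX] at hX6 hMX
  have hX0 : 0 < X := by linarith
  have hX1 : 1 ≤ X := by linarith
  have hnm : 1 ≤ n * m := Nat.mul_pos hn hm
  have hK := net_size_le hn hm hε.1 hr.1 iε ir hX6 (by linarith) (by linarith) (by linarith)
    (by linarith)
  have hexp := exp_neg_sample_le (k := 11 * (n * m)) (M := M) (ε := ε) hr.1 hX1 hB0 hB
    (by refine le_trans (le_of_eq ?_) hMX; push_cast; ring)
  have hKm := pow_le_pow_left₀ (by positivity) hK m
  calc ((⌈320 * (n * m * 2 ^ n) / (ε * r)⌉₊ : ℝ) + 1) ^ m *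
        (2 * Real.exp (-(M * (ε / 16) ^ 2) / (2 * B ^ 2)))
      -- The exponent `11 n m` pays for the net (`9 n m`), the factor 2 (one `X`) and `δ ≥ 1 / X`
      -- (another).
      ≤ (X ^ (9 * n)) ^ m * (X * (X ^ (11 * (n * m)))⁻¹) :=
        mul_le_mul hKm (mul_le_mul (by linarith) hexp (Real.exp_pos _).le hX0.le)
          (by positivity) (by positivity)
    _ = X ^ (9 * (n * m) + 1) * (X ^ (11 * (n * m)))⁻¹ := by
        rw [← pow_mul, pow_succ, mul_assoc 9 n m, mul_assoc]
    _ ≤ X⁻¹ := by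
        rw [← div_eq_mul_inv, div_le_iff₀ (by positivity), ← div_eq_inv_mul, le_div_iff₀ hX0,
          ← pow_succ]
        exact pow_le_pow_right₀ hX1 (by omega)
    _ ≤ δ := by
        rw [inv_le_comm₀ hX0 hδ.1, ← one_div]
        linarith

/-! ### The learner and its guarantee. -/

/-- Approximate empirical risk minimization learns every regular diffusion model. -/
theorem exists_learner {V : Type u} [Fintype V] {Ω : Type u} [MeasureSpace Ω]
    [IsProbabilityMeasure (volume : Measure Ω)] {E : Finset (V × V)}
    {model : (E → ℝ) → Set V → Ω → Set V} (hmodel : IsRegular model) {W : Set (E → ℝ)}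
    (hW : ∀ w ∈ W, ∀ e, w e ∈ Set.Icc (0 : ℝ) 1) {rbar η : ℝ} (hrbar : 0 < rbar)
    (hη : η ∈ Set.Ico (0 : ℝ) 1) :
    ∃ L : Learner V, IsProper model W L ∧
      LearnsUnderIntervalRate model W L 150000 1 rbar η := by
  rcases W.eq_empty_or_nonempty with rfl | hne
  · exact ⟨fun _ _ _ _ => 0, fun h => absurd h Set.not_nonempty_empty,
      fun _ _ _ _ w hw => absurd hw (Set.notMem_empty w)⟩
  set B : ℝ := 1 + 2 / rbar
  have hB0 : 0 < B := by positivity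
  have hF : ∀ w S v, influence (model w) S v ∈ Set.Icc (0 : ℝ) 1 := fun w =>
    influence_mem_Icc (model w)
  have hlossB : ∀ w x, |cascadeLoss rbar (influence (model w)) x| ≤ B := fun w =>
    abs_cascadeLoss_le hrbar (hF w)
  have hmin : ∀ (M : ℕ) (D : Fin M → Set V × Set V), ∃ w ∈ W, ∀ w' ∈ W,
      ∑ i, cascadeLoss rbar (influence (model w)) (D i) ≤
        ∑ i, cascadeLoss rbar (influence (model w')) (D i) + 1 := by
    intro M D
    refine exists_almost_minimizer hne (b := ∑ _i : Fin M, -B) fun w _ => ?_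
    exact Finset.sum_le_sum fun i _ => (abs_le.1 (hlossB w (D i))).1
  choose what hwhat herm using hmin
  refine ⟨fun M D => influence (model (what M D)), fun _ M D => ⟨_, hwhat M D, rfl⟩, ?_⟩
  intro ε hε δ hδ w hw P hP r hr hr1 M hM
  obtain ⟨hη0, hη1⟩ := hη
  have hη' : 0 < 1 - η := by linarith
  have hr0 : 0 < r := lt_of_lt_of_le (by positivity) hr.1
  have hbias : 4 * η ^ 2 ≤ 4 * η ^ 2 / (1 - η) ^ 2 :=
    le_div_self (by positivity) (by positivity) (pow_le_one₀ hη'.le (by linarith))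
  -- Without edges the sample bound is 0, so `M = 0` must be allowed; but then the parameter vector
  -- is unique and the excess error vanishes.
  rcases Nat.eq_zero_or_pos E.card with hE | hm
  · have : IsEmpty E := by rw [Finset.card_eq_zero.1 hE]; infer_instance
    have hempty : {x : Fin M → Set V × Ω × (V → unitInterval) |
        ε + 4 * η ^ 2 / (1 - η) ^ 2 ≤
          sqErr P (model w) (influence (model (what M fun i =>
            incompleteCascade (model w) r (x i)))) -
          sqErr P (model w) (influence (model w))} = ∅ := by
      refine Set.eq_empty_of_forall_notMem fun x hx => ?_
      rw [Set.mem_ofPred_eq, Subsingleton.elim (what M _) w, sub_self] at hx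
      have : 0 ≤ 4 * η ^ 2 := by positivity
      linarith [hε.1]
    rw [hempty, measure_empty]
    exact zero_le
  have hn : 1 ≤ Fintype.card V := by
    obtain ⟨e, -⟩ := Finset.card_pos.1 hm
    exact Fintype.card_pos_iff.2 ⟨e.1⟩
  have hn' : (1 : ℝ) ≤ Fintype.card V := by exact_mod_cast hn
  have hm' : (1 : ℝ) ≤ E.card := by exact_mod_cast hm
  obtain ⟨-, hMε, -⟩ := sampleBound_lower_bounds hn hm hε hδ ⟨hr0, hr1⟩ ⟨hη0, hη1⟩ hM
  have hM0 : (0 : ℝ) < M := lt_trans (div_pos (by norm_num) hε.1) hMε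
  have hrate : |r / rbar - 1| ≤ η := by
    rw [abs_le]
    constructor
    · rw [neg_le_sub_iff_le_add, ← sub_le_iff_le_add, le_div_iff₀ hrbar]
      linarith [hr.1]
    · rw [sub_le_iff_le_add, div_le_iff₀ hrbar]
      linarith [hr.2]
  -- The upper end of the rate interval gives `r ≤ 2 rbar`, turning the nominal rate into the true
  -- one.
  have hBr : B ≤ 5 / r := by
    have h1 : 1 ≤ 1 / r := (one_le_div hr0).2 hr1
    have h2 : 2 / rbar ≤ 4 / r := by
      rw [div_le_div_iff₀ hrbar hr0]
      nlinarith [hr.2]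
    calc B ≤ 1 / r + 4 / r := add_le_add h1 h2
      _ = 5 / r := by ring
  set n := Fintype.card V
  set m := E.card
  -- The net serves only the analysis, so it may depend on `ε` and `r`. Its mesh makes influence
  -- vary by at most `εr / 320`, hence the loss by `2Bβ ≤ ε / 32`.
  set K := ⌈320 * ((n : ℝ) * m * 2 ^ n) / (ε * r)⌉₊
  have hεr : 0 < ε * r := mul_pos hε.1 hr0
  have hKle : 320 * ((n : ℝ) * m * 2 ^ n) / (ε * r) ≤ K := Nat.le_ceil _
  have hK0 : 0 < K := Nat.ceil_pos.2 (by positivity)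
  have hKr : (0 : ℝ) < K := by exact_mod_cast hK0
  obtain ⟨c, hcW, hc⟩ := exists_finite_net hne hW hK0
  set β := (n * 2 ^ n : ℝ) * (m * (1 / K)) with hβ
  have hβ0 : 0 ≤ β := by positivity
  have hBβ : B * β ≤ ε / 64 := by
    have h1 : β ≤ ε * r / 320 := by
      rw [div_le_iff₀ hεr] at hKle
      rw [hβ, le_div_iff₀ (by norm_num)]
      calc (n * 2 ^ n : ℝ) * (m * (1 / K)) * 320 = 320 * ((n : ℝ) * m * 2 ^ n) / K := by ring
        _ ≤ ε * r := by rw [div_le_iff₀ hKr]; linarith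
    calc B * β ≤ 5 / r * (ε * r / 320) := by gcongr
      _ = ε / 64 := by field_simp; ring
  set μ : Measure (Set V × Ω × (V → unitInterval)) :=
    P.prod ((volume : Measure Ω).prod (volume : Measure (V → unitInterval)))
  set loss : (E → ℝ) → Set V × Ω × (V → unitInterval) → ℝ := fun w' x =>
    cascadeLoss rbar (influence (model w')) (incompleteCascade (model w) r x)
  have hlossm : ∀ w', Measurable (loss w') := fun w' =>
    (measurable_of_countable (cascadeLoss rbar (influence (model w')))).comp
      (measurable_incompleteCascade (hmodel.measurableSet_mem w) r)
  have hlossi : ∀ w', Integrable (loss w') μ := fun w' =>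
    Integrable.of_bound (hlossm w').aestronglyMeasurable B
      (ae_of_all _ fun x => hlossB w' _)
  have hnear : ∀ w' ∈ W, ∃ a, ∀ x, |loss w' x - loss (c a) x| ≤ ε / 32 := by
    intro w' hw'
    obtain ⟨a, ha⟩ := hc w' hw'
    refine ⟨a, fun x => ?_⟩
    refine (abs_cascadeLoss_sub_le hrbar (hF w') (hF (c a)) hβ0
      (hmodel.influence_lipschitz w' (c a) _ ha (by positivity)) _).trans ?_
    rw [mul_assoc]
    linarith
  -- Error budget: `ε / 16` at the net point, plus `ε / 32` each for moving the empirical and the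
  -- expected loss.
  have hgood : ∀ x : Fin M → Set V × Ω × (V → unitInterval),
      (∀ a, |∑ j, loss (c a) (x j) - M * ∫ y, loss (c a) y ∂μ| < M * (ε / 16)) →
      ∀ w' ∈ W, |∑ j, loss w' (x j) - M * ∫ y, loss w' y ∂μ| ≤ M * (ε / 8) := by
    intro x hx w' hw'
    obtain ⟨a, ha⟩ := hnear w' hw'
    have h1 : |∑ j, loss w' (x j) - ∑ j, loss (c a) (x j)| ≤ M * (ε / 32) := by
      rw [← Finset.sum_sub_distrib]
      refine (Finset.abs_sum_le_sum_abs _ _).trans ?_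
      refine (Finset.sum_le_card_nsmul _ _ (ε / 32) fun j _ => ha (x j)).trans_eq ?_
      simp
    have h2 : |∫ y, loss w' y ∂μ - ∫ y, loss (c a) y ∂μ| ≤ ε / 32 := by
      rw [← integral_sub (hlossi w') (hlossi (c a))]
      have h := norm_integral_le_of_norm_le_const (μ := μ) (C := ε / 32)
        (f := fun y => loss w' y - loss (c a) y) (ae_of_all _ fun y => ha y)
      rwa [probReal_univ, mul_one] at h
    have h3 : |M * ∫ y, loss w' y ∂μ - M * ∫ y, loss (c a) y ∂μ| ≤ M * (ε / 32) := by
      rw [← mul_sub, abs_mul, abs_of_pos hM0]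
      exact mul_le_mul_of_nonneg_left h2 hM0.le
    have h4 := hx a
    rw [abs_le] at h1 h3 ⊢
    rw [abs_lt] at h4
    constructor <;> linarith [h1.1, h1.2, h3.1, h3.2, h4.1, h4.2]
  have hsub : {x : Fin M → Set V × Ω × (V → unitInterval) |
      ε + 4 * η ^ 2 / (1 - η) ^ 2 ≤
        sqErr P (model w) (influence (model (what M fun i =>
          incompleteCascade (model w) r (x i)))) -
        sqErr P (model w) (influence (model w))} ⊆
      {x | ∃ a, M * (ε / 16) ≤ |∑ j, loss (c a) (x j) - M * ∫ y, loss (c a) y ∂μ|} := by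
    intro x hx
    rw [Set.mem_ofPred_eq] at hx ⊢
    by_contra! hcon
    set v := what M fun i => incompleteCascade (model w) r (x i)
    have hvW : v ∈ W := hwhat _ _
    have h1 := hgood x hcon v hvW
    have h2 := hgood x hcon w hw
    have h3 : ∑ j, loss v (x j) ≤ ∑ j, loss w (x j) + 1 := herm M _ w hw
    have h4 : sqErr P (model w) (influence (model v)) -
        sqErr P (model w) (influence (model w)) ≤
        2 * (∫ y, loss v y ∂μ - ∫ y, loss w y ∂μ) + 4 * η ^ 2 :=
      excess_sqErr_le P (hmodel.measurableSet_mem w) (hmodel.seeds_subset w) ⟨hr0.le, hr1⟩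
        hrate fun S u hu => influence_eq_one_of_mem (hmodel.seeds_subset v) hu
    rw [abs_le] at h1 h2
    -- Two deviations of `ε / 8` and the slack `1 / M < ε / 4` keep the excess loss below `ε / 2`;
    -- the factor 2 in the bias bound makes this `ε`.
    have h5 : M * (∫ y, loss v y ∂μ - ∫ y, loss w y ∂μ) ≤ M * (ε / 4) + 1 := by
      linarith [h1.1, h2.2]
    have h6 : 4 < M * ε := (div_lt_iff₀ hε.1).1 hMε
    have h7 : M * (∫ y, loss v y ∂μ - ∫ y, loss w y ∂μ) < M * (ε / 2) := by linarith
    have h8 := lt_of_mul_lt_mul_left h7 hM0.le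
    linarith
  classical
  have hprob := measure_exists_deviation_le μ (g := fun a => loss (c a))
    (fun a => hlossm (c a)) (fun a x => hlossB (c a) _) M (t := ε / 16) (by linarith [hε.1])
  have hcard : (Fintype.card (E → Fin (K + 1)) : ℝ) = ((K : ℝ) + 1) ^ m := by
    rw [Fintype.card_fun, Fintype.card_fin, Fintype.card_coe]
    push_cast
    rfl
  rw [hcard] at hprob
  have hfin := hprob.trans
    (net_failure_le hn hm hε hδ ⟨hr0, hr1⟩ ⟨hη0, hη1⟩ hM hB0 hBr)
  refine (measure_mono hsub).trans ?_
  rw [sampleLaw, ← ofReal_measureReal]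
  exact ENNReal.ofReal_le_ofReal hfin

end Diffusion

end

theorem theorem5 :
    ∃ (C : ℝ) (k : ℕ), 0 < C ∧
      ∀ (V : Type u) [Fintype V] (E : Finset (V × V)) (lam rbar η : ℝ),
        lam ∈ Set.Ioo (0 : ℝ) (1 / 2) → 0 < rbar → η ∈ Set.Ico (0 : ℝ) 1 →
        (∃ L : Diffusion.Learner V,
          Diffusion.IsProper Diffusion.dicFinal (Diffusion.dicParams E lam) L ∧
          Diffusion.LearnsUnderIntervalRate Diffusion.dicFinal (Diffusion.dicParams E lam) L
            C k rbar η) ∧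
        (∃ L : Diffusion.Learner V,
          Diffusion.IsProper Diffusion.dltFinal (Diffusion.dltParams E lam) L ∧
          Diffusion.LearnsUnderIntervalRate Diffusion.dltFinal (Diffusion.dltParams E lam) L
            C k rbar η) := by
  refine ⟨150000, 1, by norm_num, fun V _ E lam rbar η hlam hrbar hη => ⟨?_, ?_⟩⟩
  · refine Diffusion.exists_learner (Diffusion.isRegular_dicFinal E) (fun w hw e => ?_) hrbar hη
    exact ⟨hlam.1.le.trans (hw e).1, (hw e).2.trans (by linarith [hlam.1])⟩
  · refine Diffusion.exists_learner (Diffusion.isRegular_dltFinal E) (fun w hw e => ?_) hrbar hη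
    exact ⟨hlam.1.le.trans (hw.1 e).1, (hw.1 e).2.trans (by linarith [hlam.1])⟩
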